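/- Let $E\neq\{0\}$ be a real or complex Hilbert space. Write $\mathrm{Sym}(E)$ for the bounded self-adjoint operators on $E$, $\mathcal P_0\subset \mathrm{Sym}(E)$ for the positive semidefinite invertible ones, and $\le$ for the Loewner order. For $X\in\mathrm{Sym}(E)$ and $Y\in\mathcal P_0$ put $M(X/Y)=\inf\{t\in\mathbb R: X\le tY\}$ and $m(X/Y)=\sup\{t\in\mathbb R: X\ge tY\}$; the Thompson metric on $\mathcal P_0$ is $d_T(P,Q)=\log\max\{M(P/Q),M(Q/P)\}$. Let $A$ (bounded operators) and $D,\Sigma$ (with values in $\mathrm{Sym}(E)$) be continuous and bounded functions of $t\in\mathbb R$, and consider on $\mathrm{Sym}(E)$ the Riccati equation $$\dot P(t)=A(t)'P(t)+P(t)A(t)+D(t)-P(t)\Sigma(t)P(t).$$ Let $M_s^t(P_0)$ be the value at time $t$ of the maximal solution with value $P_0$ at time $s$, and let $t_{\mathcal P_0}(s,P_0)$ be the first time at which this solution leaves $\mathcal P_0$, that is, the supremum of the $b>s$ such that it exists and stays in $\mathcal P_0$ on $[s,b)$. Call $\alpha\in\mathbb R$ an admissible rate if $$d_T(M_s^t(P_1),M_s^t(P_2))\le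 e^{-\alpha(t-s)}d_T(P_1,P_2)$$ for all $P_1,P_2\in\mathcal P_0$, all $s\ge 0$ and all $t$ with $s\le t<\min\{t_{\mathcal P_0}(s,P_1),t_{\mathcal P_0}(s,P_2)\}$. The contraction rate is the best (greatest) admissible rate, understood as the supremum in $[-\infty,+\infty]$ of the admissible rates. 1. The contraction rate equals $$\sup\{\beta\in\mathbb R:\ P\Sigma(t)P+D(t)\ge\beta P\ \text{ for all } t\ge 0 \text{ and all } P\in\mathcal P_0\}$$ (both being $-\infty$ if there is no such $\beta$); if such a $\beta$ exists, this supremum is finite and is itself the greatest admissible rate. 2. If $D(t)$ and $\Sigma(t)$ are positive semidefinite for all $t\ge 0$, then the contraction rate equals $$2\inf_{t\ge 0}\sqrt{m\big((\Sigma(t)^{1/2}D(t)\Sigma(t)^{1/2})/I\big)},$$ and this number is the greatest admissible rate. -/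

import Mathlib

open scoped InnerProductSpace

noncomputable section

namespace Riccati

section General

variable {X : Type*}

/-- `M(x/y) = inf {t ∈ ℝ : x ≤ t y}`. -/
def upperRatio [LE X] [SMul ℝ X] (x y : X) : ℝ := sInf {t : ℝ | x ≤ t • y}

/-- `m(x/y) = sup {t ∈ ℝ : t y ≤ x}`. -/
def lowerRatio [LE X] [SMul ℝ X] (x y : X) : ℝ := sSup {t : ℝ | t • y ≤ x}

/-- The Thompson part metric `d_T(x, y) = log (max (M(x/y), M(y/x)))`
(meaningful for `x`, `y` in the interior of the cone). -/
def thompsonDist [LE X] [SMul ℝ X] (x y : X) : ℝ :=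
  Real.log (max (upperRatio x y) (upperRatio y x))

variable [NormedAddCommGroup X] [NormedSpace ℝ X]

/-- `x` is a solution on `[s, b)`, with values in `𝒟`, of `x'(t) = φ(t, x(t))`
(the derivative is one-sided at the left end point `s`). -/
def IsSolution (φ : ℝ → X → X) (𝒟 : Set X) (s b : ℝ) (x : ℝ → X) : Prop :=
  ∀ t ∈ Set.Ico s b, x t ∈ 𝒟 ∧ HasDerivWithinAt x (φ t (x t)) (Set.Ico s b) t

open Classical in
/-- The flow `M_s^t(x₀)`: the value at time `t` of the solution in `𝒟` that starts from `x₀` at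
time `s`. The value is `0` if no such solution lives beyond time `t`. -/
def flow (φ : ℝ → X → X) (𝒟 : Set X) (s t : ℝ) (x₀ : X) : X :=
  if h : ∃ x : ℝ → X, (∃ b : ℝ, t < b ∧ IsSolution φ 𝒟 s b x) ∧ x s = x₀ then h.choose t else 0

/-- The first exit time `t_U(s, x₀) ∈ [-∞, +∞]`: the supremum of the times `b > s` such that the
solution in `𝒟` starting from `x₀` at time `s` exists and stays in `U` on `[s, b)`. -/
def exitTime (φ : ℝ → X → X) (𝒟 U : Set X) (s : ℝ) (x₀ : X) : EReal :=
  sSup {e : EReal | ∃ b : ℝ, e = (b : EReal) ∧ s < b ∧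
    ∃ x : ℝ → X, IsSolution φ 𝒟 s b x ∧ x s = x₀ ∧ ∀ t ∈ Set.Ico s b, x t ∈ U}

/-- The flow of `φ` satisfies, on `U` and for all starting times `s ≥ 0`,
`d_T(M_s^t(x₁), M_s^t(x₂)) ≤ exp(-α (t - s)) d_T(x₁, x₂)`
as long as both trajectories stay in `U`. -/
def ContractsAtRate [LE X] (φ : ℝ → X → X) (𝒟 U : Set X) (α : ℝ) : Prop :=
  ∀ x₁ ∈ U, ∀ x₂ ∈ U, ∀ s t : ℝ, 0 ≤ s → s ≤ t →
    (t : EReal) < min (exitTime φ 𝒟 U s x₁) (exitTime φ 𝒟 U s x₂) →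
      thompsonDist (flow φ 𝒟 s t x₁) (flow φ 𝒟 s t x₂) ≤
        Real.exp (-α * (t - s)) * thompsonDist x₁ x₂

/-- The best contraction rate of the flow on `U`, as an extended real number
(`-∞` if there is no admissible rate at all). -/
def bestContractionRate [LE X] (φ : ℝ → X → X) (𝒟 U : Set X) : EReal :=
  sSup ((fun α : ℝ => (α : EReal)) '' {α : ℝ | ContractsAtRate φ 𝒟 U α})

end General

section Operators

variable {𝕜 E : Type*} [RCLike 𝕜] [NormedAddCommGroup E] [InnerProductSpace 𝕜 E] [CompleteSpace E]

/-- The symmetric bounded operators. -/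
def symOps (𝕜 E : Type*) [RCLike 𝕜] [NormedAddCommGroup E] [InnerProductSpace 𝕜 E]
    [CompleteSpace E] : Set (E →L[𝕜] E) := {P | IsSelfAdjoint P}

/-- The positive semidefinite invertible bounded operators. -/
def posInvOps (𝕜 E : Type*) [RCLike 𝕜] [NormedAddCommGroup E] [InnerProductSpace 𝕜 E] :
    Set (E →L[𝕜] E) := {P | P.IsPositive ∧ IsUnit P}

open Classical in
/-- The positive semidefinite square root `T^{1/2}` of a positive semidefinite operator `T`
(with value `0` at operators that have none). -/
def opSqrt (T : E →L[𝕜] E) : E →L[𝕜] E :=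
  if h : ∃ R : E →L[𝕜] E, R.IsPositive ∧ R * R = T then h.choose else 0

/-- The right-hand side `φ(t, P) = A(t)' P + P A(t) + D(t) - P Σ(t) P` of the standard Riccati
differential equation. -/
def riccatiField (A D S : ℝ → E →L[𝕜] E) (t : ℝ) (P : E →L[𝕜] E) : E →L[𝕜] E :=
  ContinuousLinearMap.adjoint (A t) * P + P * A t + D t - P * S t * P

/-- The set of `β ∈ ℝ` with `P Σ(t) P + D(t) ≥ β P` for all `t ≥ 0` and all positive semidefinite
invertible `P`, in the Loewner order. -/
def riccatiRates [NormedSpace ℝ E] [IsScalarTower ℝ 𝕜 E] (D S : ℝ → E →L[𝕜] E) : Set ℝ :=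
  {β : ℝ | ∀ t : ℝ, 0 ≤ t → ∀ P ∈ posInvOps 𝕜 E, β • P ≤ P * S t * P + D t}

end Operators

end Riccati

end

/-!
For `P`, `Q` positive semidefinite and invertible, `d_T(P, Q) ≤ r` means `P ≤ e^r Q` and
`Q ≤ e^r P`, so a contraction estimate is a statement about order bounds along the flow.

If `β P ≤ P Σ P + D` for all `P`, write this inequality for `τ Q`, divide it by `τ²` and integrate
over `1 ≤ τ ≤ c`, where `Q` is a solution. The result says precisely that `c Q` with
`c(t) = exp(e^{-β(t - s)} d)` is a supersolution, and the comparison principle gives `P ≤ c Q`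
whenever this holds at time `s`. The difference of a supersolution and a solution satisfies a
Lyapunov inequality, whence the comparison principle. Conversely, comparing the derivatives at time
`s` of the solutions that start from `c P` and `P` recovers the integrated inequality, and its
derivative at `c = 1` is the original one.

For positive semidefinite data and `R = Σ^{1/2}`, completing the square in `R (P R² P + D - β P) R`
shows that `β > 0` is a rate if and only if `(β/2)² ≤ R D R`, the extremal choice being
`P = (β/2) R⁻²`, up to a regularization of `R`.

Square roots are obtained from the generating series of the Catalan numbers, which works over `ℝ`
as well as over `ℂ`.
-/

open scoped InnerProductSpace

noncomputable section

namespace Riccati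

open Set Filter Topology ContinuousLinearMap

section OrderedModule

variable {X : Type*} [AddCommGroup X] [PartialOrder X] [IsOrderedAddMonoid X] [Module ℝ X]

lemma lowerRatio_eq_neg_upperRatio_neg (x y : X) : lowerRatio x y = -upperRatio (-x) y := by
  rw [lowerRatio, upperRatio, ← Real.sSup_neg]
  congr 1 with t
  simp [neg_le_neg_iff]

variable [IsStrictOrderedModule ℝ X] [TopologicalSpace X] [OrderClosedTopology X]
  [ContinuousSMul ℝ X] {x y : X}

lemma upperRatio_le_iff (hy : 0 < y) (hlower : ∃ a : ℝ, a • y ≤ x) (hupper : ∃ b : ℝ, x ≤ b • y)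
    {c : ℝ} : upperRatio x y ≤ c ↔ x ≤ c • y := by
  obtain ⟨a, ha⟩ := hlower
  have hbdd : BddBelow {t : ℝ | x ≤ t • y} :=
    ⟨a, fun t ht => le_of_smul_le_smul_right (ha.trans ht) hy⟩
  have hclosed : IsClosed {t : ℝ | x ≤ t • y} :=
    isClosed_Ici.preimage (continuous_id.smul continuous_const)
  exact ⟨fun h => (hclosed.csInf_mem hupper hbdd : x ≤ upperRatio x y • y).trans
    (smul_le_smul_of_nonneg_right h hy.le), fun h => csInf_le hbdd h⟩

lemma le_lowerRatio_iff (hy : 0 < y) (hlower : ∃ a : ℝ, a • y ≤ x) (hupper : ∃ b : ℝ, x ≤ b • y)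
    {c : ℝ} : c ≤ lowerRatio x y ↔ c • y ≤ x := by
  obtain ⟨a, ha⟩ := hlower
  obtain ⟨b, hb⟩ := hupper
  rw [lowerRatio_eq_neg_upperRatio_neg, le_neg, upperRatio_le_iff hy
    ⟨-b, by simpa only [neg_smul, neg_le_neg_iff] using hb⟩
    ⟨-a, by simpa only [neg_smul, neg_le_neg_iff] using ha⟩, neg_smul, neg_le_neg_iff]

lemma thompsonDist_le_iff (hx : 0 < x) (hy : 0 < y) (hxy : ∃ b : ℝ, x ≤ b • y)
    (hyx : ∃ b : ℝ, y ≤ b • x) {r : ℝ} :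
    thompsonDist x y ≤ r ↔ x ≤ Real.exp r • y ∧ y ≤ Real.exp r • x := by
  have hx_iff {c : ℝ} : upperRatio x y ≤ c ↔ x ≤ c • y :=
    upperRatio_le_iff hy ⟨0, by simpa only [zero_smul] using hx.le⟩ hxy
  have hy_iff {c : ℝ} : upperRatio y x ≤ c ↔ y ≤ c • x :=
    upperRatio_le_iff hx ⟨0, by simpa only [zero_smul] using hy.le⟩ hyx
  have hpos : 0 < upperRatio x y := by
    by_contra! h
    exact hx.not_ge (by simpa only [zero_smul] using hx_iff.mp h)
  rw [thompsonDist, Real.log_le_iff_le_exp (lt_max_of_lt_left hpos), max_le_iff, hx_iff, hy_iff]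

lemma thompsonDist_nonneg (hx : 0 < x) (hy : 0 < y) (hxy : ∃ b : ℝ, x ≤ b • y)
    (hyx : ∃ b : ℝ, y ≤ b • x) : 0 ≤ thompsonDist x y := by
  obtain ⟨h₁, h₂⟩ := (thompsonDist_le_iff hx hy hxy hyx).mp le_rfl
  set c := Real.exp (thompsonDist x y)
  have hsq : (1 : ℝ) • x ≤ (c * c) • x := by
    rw [one_smul, mul_smul]
    exact h₁.trans (smul_le_smul_of_nonneg_left h₂ (Real.exp_pos _).le)
  have hc : 1 ≤ c * c := le_of_smul_le_smul_right hsq hx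
  exact Real.one_le_exp_iff.mp (by nlinarith [Real.exp_pos (thompsonDist x y)])

lemma thompsonDist_smul_self_le (hx : 0 < x) {c : ℝ} (hc : 1 ≤ c) :
    thompsonDist (c • x) x ≤ Real.log c := by
  have hc₀ : 0 < c := zero_lt_one.trans_le hc
  have hle {d : ℝ} (hd : 1 ≤ d) : x ≤ d • x := le_smul_of_one_le_left hx.le hd
  have hx_le : x ≤ c • c • x := by
    rw [← mul_smul]
    exact hle (one_le_mul_of_one_le_of_one_le hc hc)
  rw [thompsonDist_le_iff (smul_pos hc₀ hx) hx ⟨c, le_rfl⟩ ⟨c, hx_le⟩, Real.exp_log hc₀]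
  exact ⟨le_rfl, hx_le⟩

end OrderedModule

section OneSidedDerivative

lemma hasDerivWithinAt_Ioi_of_Ico {F : Type*} [NormedAddCommGroup F] [NormedSpace ℝ F]
    {f : ℝ → F} {f' : F} {s b t : ℝ} (ht : t ∈ Ico s b)
    (hf : HasDerivWithinAt f f' (Ico s b) t) : HasDerivWithinAt f f' (Ioi t) t :=
  (hf.mono (Ico_subset_Ico_left ht.1)).mono_of_mem_nhdsWithin
    (mem_of_superset (Ioo_mem_nhdsGT ht.2) Ioo_subset_Ico_self)

lemma hasDerivWithinAt_Ioi_le_of_eventually_le {F : Type*} [NormedAddCommGroup F]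
    [PartialOrder F] [IsOrderedAddMonoid F] [NormedSpace ℝ F] [PosSMulMono ℝ F]
    [OrderClosedTopology F] {f g : ℝ → F} {f' g' : F} {s : ℝ}
    (hf : HasDerivWithinAt f f' (Ioi s) s) (hg : HasDerivWithinAt g g' (Ioi s) s)
    (heq : f s = g s) (hle : ∀ᶠ t in 𝓝[>] s, f t ≤ g t) : f' ≤ g' := by
  rw [hasDerivWithinAt_iff_tendsto_slope' self_notMem_Ioi] at hf hg
  refine le_of_tendsto_of_tendsto hf hg ?_
  filter_upwards [hle, self_mem_nhdsWithin] with t ht hst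
  rw [slope_def_module, slope_def_module, heq]
  exact smul_le_smul_of_nonneg_left (sub_le_sub_right ht _)
    (inv_nonneg.mpr (sub_nonneg.mpr (le_of_lt hst)))

end OneSidedDerivative

section CatalanSeries

open Finset in
lemma sum_range_catalan_div_four_pow (N : ℕ) :
    ∑ n ∈ range N, (catalan n : ℝ) / 4 ^ n = 2 * (1 - (Nat.centralBinom N : ℝ) / 4 ^ N) := by
  induction N with
  | zero => simp
  | succ N ih =>
    have hcat : ((N : ℝ) + 1) * catalan N = Nat.centralBinom N := by
      exact_mod_cast succ_mul_catalan_eq_centralBinom N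
    have hbinom : ((N : ℝ) + 1) * Nat.centralBinom (N + 1) =
        2 * (2 * N + 1) * (((N : ℝ) + 1) * catalan N) := by
      rw [hcat]
      exact_mod_cast Nat.succ_mul_centralBinom_succ N
    have hbinom' : (Nat.centralBinom (N + 1) : ℝ) = 2 * (2 * N + 1) * catalan N :=
      mul_left_cancel₀ (Nat.cast_add_one_ne_zero N) (by rw [hbinom]; ring)
    rw [sum_range_succ, ih, hbinom', ← hcat]
    field_simp
    ring

lemma sum_range_catalan_div_four_pow_le (N : ℕ) :
    ∑ n ∈ Finset.range N, (catalan n : ℝ) / 4 ^ n ≤ 2 := by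
  have : 0 ≤ (Nat.centralBinom N : ℝ) / 4 ^ N := by positivity
  linarith [sum_range_catalan_div_four_pow N]

lemma summable_catalan_div_four_pow : Summable fun n : ℕ => (catalan n : ℝ) / 4 ^ n :=
  summable_of_sum_range_le (fun _ => by positivity) sum_range_catalan_div_four_pow_le

variable {R : Type*} [NormedRing R]

/-- The generating series `∑ C_n b^(n + 1)` of the Catalan numbers at an element `b` of a normed
ring, which converges for `‖b‖ ≤ 1/4`. It plays the role of `(1 - √(1 - 4 b)) / 2`. -/
def catalanSeries (b : R) : R := ∑' n : ℕ, catalan n • b ^ (n + 1)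

lemma norm_catalan_smul_pow_le {b : R} (hb : ‖b‖ ≤ 1 / 4) (n : ℕ) :
    ‖catalan n • b ^ (n + 1)‖ ≤ (catalan n : ℝ) / 4 ^ n * (1 / 4) := by
  calc ‖catalan n • b ^ (n + 1)‖ ≤ catalan n * ‖b‖ ^ (n + 1) :=
        (norm_nsmul_le).trans (by gcongr; exact norm_pow_le' b n.succ_pos)
    _ ≤ catalan n * (1 / 4) ^ (n + 1) := by gcongr
    _ = (catalan n : ℝ) / 4 ^ n * (1 / 4) := by rw [pow_succ, one_div_pow]; ring

lemma summable_norm_catalan_smul_pow {b : R} (hb : ‖b‖ ≤ 1 / 4) :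
    Summable fun n : ℕ => ‖catalan n • b ^ (n + 1)‖ :=
  (summable_catalan_div_four_pow.mul_right _).of_nonneg_of_le (fun _ => norm_nonneg _)
    (norm_catalan_smul_pow_le hb)

lemma norm_catalanSeries_le {b : R} (hb : ‖b‖ ≤ 1 / 4) : ‖catalanSeries b‖ ≤ 1 / 2 :=
  calc ‖catalanSeries b‖ ≤ ∑' n : ℕ, (catalan n : ℝ) / 4 ^ n * (1 / 4) :=
        tsum_of_norm_bounded (summable_catalan_div_four_pow.mul_right _).hasSum
          (norm_catalan_smul_pow_le hb)
    _ = (∑' n : ℕ, (catalan n : ℝ) / 4 ^ n) * (1 / 4) := tsum_mul_right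
    _ ≤ 2 * (1 / 4) := by
        gcongr
        exact Real.tsum_le_of_sum_range_le (fun _ => by positivity)
          sum_range_catalan_div_four_pow_le
    _ = 1 / 2 := by norm_num

lemma catalanSeries_eq_add_mul_self [CompleteSpace R] {b : R} (hb : ‖b‖ ≤ 1 / 4) :
    catalanSeries b = b + catalanSeries b * catalanSeries b := by
  have hsum := summable_norm_catalan_smul_pow hb
  rw [catalanSeries, tsum_mul_tsum_eq_tsum_sum_antidiagonal_of_summable_norm hsum hsum,
    hsum.of_norm.tsum_eq_zero_add]
  congr 1
  · simp
  · refine tsum_congr fun n => ?_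
    rw [catalan_succ', Finset.sum_smul]
    refine Finset.sum_congr rfl fun ij hij => ?_
    rw [smul_mul_smul_comm, ← pow_add, ← Finset.HasAntidiagonal.mem_antidiagonal.mp hij]
    congr 2
    ring

lemma one_sub_two_smul_catalanSeries_mul_self [CompleteSpace R] {b : R} (hb : ‖b‖ ≤ 1 / 4) :
    (1 - 2 • catalanSeries b) * (1 - 2 • catalanSeries b) = 1 - 4 • b := by
  calc _ = 1 - 4 • (catalanSeries b - catalanSeries b * catalanSeries b) := by noncomm_ring
    _ = 1 - 4 • b := by
      rw [sub_eq_of_eq_add (catalanSeries_eq_add_mul_self hb)]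

lemma isSelfAdjoint_catalanSeries [StarRing R] [ContinuousStar R] {b : R}
    (hb : IsSelfAdjoint b) : IsSelfAdjoint (catalanSeries b) := by
  rw [IsSelfAdjoint, catalanSeries, tsum_star]
  exact tsum_congr fun n => by rw [star_nsmul, star_pow, hb.star_eq]

end CatalanSeries

section LoewnerOrder

variable {𝕜 E : Type*} [RCLike 𝕜] [NormedAddCommGroup E] [InnerProductSpace 𝕜 E]

instance : IsOrderedAddMonoid (E →L[𝕜] E) where
  add_le_add_left S T h C := by simpa [ContinuousLinearMap.le_def] using h

instance : ZeroLEOneClass (E →L[𝕜] E) where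
  zero_le_one := (nonneg_iff_isPositive 1).mpr isPositive_one

lemma le_iff_reApplyInnerSelf_le [CompleteSpace E] {S T : E →L[𝕜] E} (hS : IsSelfAdjoint S)
    (hT : IsSelfAdjoint T) : S ≤ T ↔ ∀ x, S.reApplyInnerSelf x ≤ T.reApplyInnerSelf x := by
  simp [ContinuousLinearMap.le_def, isPositive_def', hT.sub hS, reApplyInnerSelf_apply,
    inner_sub_left]

variable {P : E →L[𝕜] E}

lemma one_mem_posInvOps : (1 : E →L[𝕜] E) ∈ posInvOps 𝕜 E :=
  ⟨isPositive_one, isUnit_one⟩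

lemma nonneg_of_mem_posInvOps (hP : P ∈ posInvOps 𝕜 E) : 0 ≤ P :=
  (nonneg_iff_isPositive P).mpr hP.1

lemma isSelfAdjoint_of_mem_posInvOps [CompleteSpace E] (hP : P ∈ posInvOps 𝕜 E) : IsSelfAdjoint P :=
  hP.1.isSelfAdjoint

lemma pos_of_mem_posInvOps [Nontrivial E] (hP : P ∈ posInvOps 𝕜 E) : 0 < P :=
  (nonneg_of_mem_posInvOps hP).lt_of_ne' hP.2.ne_zero

variable [NormedSpace ℝ E] [IsScalarTower ℝ 𝕜 E]

instance : NormedAlgebra ℝ (E →L[𝕜] E) where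
  norm_smul_le := norm_smul_le

lemma reApplyInnerSelf_smul_one (c : ℝ) (x : E) :
    (c • (1 : E →L[𝕜] E)).reApplyInnerSelf x = c * ‖x‖ ^ 2 := by
  rw [reApplyInnerSelf_apply, RCLike.real_smul_eq_coe_smul (K := 𝕜), smul_apply, inner_smul_left,
    RCLike.conj_ofReal, RCLike.re_ofReal_mul, one_apply_eq_self, inner_self_eq_norm_sq]

instance : IsStrictOrderedModule ℝ (E →L[𝕜] E) :=
  have : IsOrderedModule ℝ (E →L[𝕜] E) := .of_smul_nonneg fun c hc T hT => by
    rw [nonneg_iff_isPositive] at hT ⊢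
    rw [RCLike.real_smul_eq_coe_smul (K := 𝕜)]
    exact hT.smul_of_nonneg (RCLike.ofReal_nonneg.mpr hc)
  { PosSMulMono.toPosSMulStrictMono, SMulPosMono.toSMulPosStrictMono with }

variable [CompleteSpace E]

instance : StarModule ℝ (E →L[𝕜] E) where
  star_smul c T := by
    simp only [RCLike.real_smul_eq_coe_smul (K := 𝕜), star_smul]
    simp

instance : OrderClosedTopology (E →L[𝕜] E) where
  isClosed_le' := by
    have hpos : IsClosed {T : E →L[𝕜] E | T.IsPositive} := by
      simp only [isPositive_def', ofPred_and, ofPred_forall]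
      refine (isClosed_eq continuous_star continuous_id).inter (isClosed_iInter fun x => ?_)
      exact isClosed_le continuous_const (by simp only [reApplyInnerSelf_apply]; fun_prop)
    exact hpos.preimage (continuous_snd.sub continuous_fst)

variable {T : E →L[𝕜] E}

lemma isSelfAdjoint_smul_one (c : ℝ) : IsSelfAdjoint (c • (1 : E →L[𝕜] E)) :=
  (IsSelfAdjoint.all c).smul (.one _)

lemma le_norm_smul_one (hT : IsSelfAdjoint T) : T ≤ ‖T‖ • 1 := by
  rw [le_iff_reApplyInnerSelf_le hT (isSelfAdjoint_smul_one _)]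
  intro x
  rw [reApplyInnerSelf_smul_one]
  calc T.reApplyInnerSelf x ≤ ‖T x‖ * ‖x‖ := re_inner_le_norm _ _
    _ ≤ ‖T‖ * ‖x‖ * ‖x‖ := by gcongr; exact T.le_opNorm x
    _ = ‖T‖ * ‖x‖ ^ 2 := by ring

lemma neg_norm_smul_one_le (hT : IsSelfAdjoint T) : (-‖T‖) • 1 ≤ T := by
  rw [neg_smul, neg_le]
  simpa only [norm_neg] using le_norm_smul_one hT.neg

lemma norm_le_of_neg_smul_one_le_of_le_smul_one {c : ℝ} (hc : 0 ≤ c) (hT : IsSelfAdjoint T)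
    (hlower : (-c) • 1 ≤ T) (hupper : T ≤ c • 1) : ‖T‖ ≤ c := by
  rw [le_iff_reApplyInnerSelf_le hT (isSelfAdjoint_smul_one c)] at hupper
  rw [le_iff_reApplyInnerSelf_le (isSelfAdjoint_smul_one (-c)) hT] at hlower
  simp only [reApplyInnerSelf_smul_one] at hlower hupper
  rw [norm_eq_iSup_rayleighQuotient T (isSelfAdjoint_iff_isSymmetric.mp hT)]
  refine ciSup_le fun x => ?_
  rw [abs_div, abs_of_nonneg (by positivity : 0 ≤ ‖x‖ ^ 2)]
  exact div_le_of_le_mul₀ (by positivity) hc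
    (abs_le.mpr ⟨by linarith [hlower x], hupper x⟩)

lemma norm_one_sub_le_one (hT : 0 ≤ T) (hT_le : T ≤ 1) : ‖1 - T‖ ≤ 1 := by
  have hT_adj : IsSelfAdjoint T := ((nonneg_iff_isPositive T).mp hT).isSelfAdjoint
  refine norm_le_of_neg_smul_one_le_of_le_smul_one zero_le_one (.sub (.one _) hT_adj) ?_ ?_
  · rw [neg_smul, one_smul]
    exact (neg_nonpos.mpr zero_le_one).trans (sub_nonneg.mpr hT_le)
  · rw [one_smul]
    exact sub_le_self _ hT

/-- The root of `1 - 4 b` is `1 - 2 Y`, where `Y` is the Catalan series of `b`; it is nonnegative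
because `‖2 Y‖ ≤ 1`. -/
lemma exists_nonneg_mul_self_eq_one_sub {B : E →L[𝕜] E} (hB : IsSelfAdjoint B) (hB_le : ‖B‖ ≤ 1) :
    ∃ R : E →L[𝕜] E, 0 ≤ R ∧ R * R = 1 - B := by
  set b := (1 / 4 : ℝ) • B with hb_def
  have hb : ‖b‖ ≤ 1 / 4 := by
    rw [hb_def, norm_smul, Real.norm_of_nonneg (by norm_num)]
    linarith
  have hY_adj : IsSelfAdjoint ((2 : ℕ) • catalanSeries b) :=
    .smul (.all _) (isSelfAdjoint_catalanSeries (.smul (.all _) hB))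
  have hY_le : ‖(2 : ℕ) • catalanSeries b‖ ≤ 1 :=
    (norm_nsmul_le).trans (by push_cast; linarith [norm_catalanSeries_le hb])
  refine ⟨1 - 2 • catalanSeries b, sub_nonneg.mpr ?_, ?_⟩
  · calc (2 : ℕ) • catalanSeries b ≤ ‖(2 : ℕ) • catalanSeries b‖ • 1 := le_norm_smul_one hY_adj
      _ ≤ (1 : ℝ) • 1 := smul_le_smul_of_nonneg_right hY_le zero_le_one
      _ = 1 := one_smul ℝ 1
  · rw [one_sub_two_smul_catalanSeries_mul_self hb, hb_def]
    module

lemma exists_nonneg_mul_self_eq (hT : 0 ≤ T) : ∃ R : E →L[𝕜] E, 0 ≤ R ∧ R * R = T := by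
  have hT_adj : IsSelfAdjoint T := ((nonneg_iff_isPositive T).mp hT).isSelfAdjoint
  have hc : 0 < ‖T‖ + 1 := by positivity
  have hle : (‖T‖ + 1)⁻¹ • T ≤ 1 := by
    rw [inv_smul_le_iff_of_pos hc]
    exact (le_norm_smul_one hT_adj).trans
      (smul_le_smul_of_nonneg_right (by simp) zero_le_one)
  obtain ⟨R, hR, hRR⟩ := exists_nonneg_mul_self_eq_one_sub
    (.sub (.one _) (.smul (.all _) hT_adj))
    (norm_one_sub_le_one (smul_nonneg (by positivity) hT) hle)
  refine ⟨√(‖T‖ + 1) • R, smul_nonneg (Real.sqrt_nonneg _) hR, ?_⟩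
  rw [smul_mul_smul_comm, Real.mul_self_sqrt hc.le, hRR, sub_sub_cancel, smul_inv_smul₀ hc.ne']

instance : StarOrderedRing (E →L[𝕜] E) :=
  .of_nonneg_iff' (fun h C => by gcongr) fun T => by
    refine ⟨fun hT => ?_, ?_⟩
    · obtain ⟨R, hR, hRR⟩ := exists_nonneg_mul_self_eq hT
      exact ⟨R, by rw [((nonneg_iff_isPositive R).mp hR).isSelfAdjoint.star_eq, hRR]⟩
    · rintro ⟨C, rfl⟩
      exact (nonneg_iff_isPositive _).mpr (isPositive_adjoint_comp_self C)

lemma opSqrt_spec (hT : 0 ≤ T) : 0 ≤ opSqrt T ∧ opSqrt T * opSqrt T = T := by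
  have h : ∃ R : E →L[𝕜] E, R.IsPositive ∧ R * R = T := by
    simpa only [nonneg_iff_isPositive] using exists_nonneg_mul_self_eq hT
  rw [opSqrt, dif_pos h, nonneg_iff_isPositive]
  exact h.choose_spec

lemma mem_posInvOps_iff : P ∈ posInvOps 𝕜 E ↔ ∃ c : ℝ, 0 < c ∧ c • 1 ≤ P := by
  constructor
  · rintro ⟨hP, hP_unit⟩
    obtain ⟨V, hVP⟩ := hP_unit.exists_left_inv
    obtain ⟨hR, hRR⟩ := opSqrt_spec ((nonneg_iff_isPositive P).mpr hP)
    set R := opSqrt P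
    have hR_adj : IsSelfAdjoint R := .of_nonneg hR
    have hone : R * (star (V * R) * (V * R)) * R = 1 := by
      calc R * (star (V * R) * (V * R)) * R = star (V * (R * R)) * (V * (R * R)) := by
            simp only [star_mul, hR_adj.star_eq, mul_assoc]
        _ = 1 := by rw [hRR, hVP, star_one, one_mul]
    set M := star (V * R) * (V * R)
    have hle : (1 : E →L[𝕜] E) ≤ (‖M‖ + 1) • P := by
      calc 1 = R * M * R := hone.symm
        _ ≤ R * (‖M‖ • 1) * R :=
          hR_adj.conjugate_le_conjugate (le_norm_smul_one (.star_mul_self _))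
        _ = ‖M‖ • P := by rw [mul_smul_comm, mul_one, smul_mul_assoc, hRR]
        _ ≤ (‖M‖ + 1) • P :=
          smul_le_smul_of_nonneg_right (by simp) ((nonneg_iff_isPositive P).mpr hP)
    exact ⟨(‖M‖ + 1)⁻¹, by positivity, (inv_smul_le_iff_of_pos (by positivity)).mpr hle⟩
  · rintro ⟨c, hc, hcP⟩
    have hP : 0 ≤ P := (smul_nonneg hc.le zero_le_one).trans hcP
    refine ⟨(nonneg_iff_isPositive P).mp hP, isUnit_of_forall_le_norm_inner_map P
      (c := ⟨c, hc.le⟩) hc fun x => ?_⟩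
    rw [le_iff_reApplyInnerSelf_le (isSelfAdjoint_smul_one c) (.of_nonneg hP)] at hcP
    specialize hcP x
    rw [reApplyInnerSelf_smul_one] at hcP
    calc ‖x‖ ^ 2 * c = c * ‖x‖ ^ 2 := mul_comm _ _
      _ ≤ RCLike.re ⟪P x, x⟫_𝕜 := hcP
      _ ≤ ‖⟪P x, x⟫_𝕜‖ := RCLike.re_le_norm _

lemma smul_mem_posInvOps (hP : P ∈ posInvOps 𝕜 E) {c : ℝ} (hc : 0 < c) :
    c • P ∈ posInvOps 𝕜 E := by
  obtain ⟨d, hd, hdP⟩ := mem_posInvOps_iff.mp hP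
  refine mem_posInvOps_iff.mpr ⟨c * d, mul_pos hc hd, ?_⟩
  rw [mul_smul]
  exact smul_le_smul_of_nonneg_left hdP hc.le

lemma exists_le_smul_of_mem_posInvOps (hT : IsSelfAdjoint T) (hP : P ∈ posInvOps 𝕜 E) :
    ∃ b : ℝ, T ≤ b • P := by
  obtain ⟨c, hc, hcP⟩ := mem_posInvOps_iff.mp hP
  refine ⟨‖T‖ * c⁻¹, (le_norm_smul_one hT).trans ?_⟩
  rw [mul_smul]
  exact smul_le_smul_of_nonneg_left ((le_inv_smul_iff_of_pos hc).mpr hcP) (norm_nonneg T)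

lemma exists_smul_le_of_mem_posInvOps (hT : IsSelfAdjoint T) (hP : P ∈ posInvOps 𝕜 E) :
    ∃ a : ℝ, a • P ≤ T := by
  obtain ⟨b, hb⟩ := exists_le_smul_of_mem_posInvOps hT.neg hP
  exact ⟨-b, by rw [neg_smul]; exact neg_le.mp hb⟩

lemma posInvOps_mem_nhdsWithin_symOps (hP : P ∈ posInvOps 𝕜 E) :
    posInvOps 𝕜 E ∈ 𝓝[symOps 𝕜 E] P := by
  obtain ⟨c, hc, hcP⟩ := mem_posInvOps_iff.mp hP
  refine Metric.mem_nhdsWithin_iff.mpr ⟨c / 2, half_pos hc, fun Q ⟨hQ, hQ_adj⟩ =>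
    mem_posInvOps_iff.mpr ⟨c / 2, half_pos hc, ?_⟩⟩
  calc (c / 2) • (1 : E →L[𝕜] E) = c • 1 + (-(c / 2)) • 1 := by module
    _ ≤ P + (-‖Q - P‖) • 1 := by
      gcongr
      exact (mem_ball_iff_norm.mp hQ).le
    _ ≤ P + (Q - P) := by
      gcongr
      exact neg_norm_smul_one_le (.sub hQ_adj (isSelfAdjoint_of_mem_posInvOps hP))
    _ = Q := by abel

end LoewnerOrder

section Solutions

open Metric
open scoped NNReal

variable {X : Type*} [NormedAddCommGroup X] [NormedSpace ℝ X] {φ : ℝ → X → X} {𝒟 U : Set X}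
  {J : Set ℝ} {s t b : ℝ} {x y : ℝ → X}

/-- The field `φ` is Lipschitz on balls, uniformly for `t` in a compact interval contained in `J`.
This is what uniqueness and local existence of solutions need. -/
def IsLipschitzOnBalls (φ : ℝ → X → X) (J : Set ℝ) : Prop :=
  ∀ a b, Icc a b ⊆ J → ∀ r, ∃ K : ℝ≥0, ∀ t ∈ Icc a b, LipschitzOnWith K (φ t) (closedBall 0 r)

lemma IsSolution.hasDerivWithinAt_Ioi (hx : IsSolution φ 𝒟 s b x) (ht : t ∈ Ico s b) :
    HasDerivWithinAt x (φ t (x t)) (Ioi t) t :=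
  hasDerivWithinAt_Ioi_of_Ico ht (hx t ht).2

lemma IsSolution.continuousOn (hx : IsSolution φ 𝒟 s b x) : ContinuousOn x (Ico s b) :=
  fun t ht => (hx t ht).2.continuousWithinAt

lemma IsSolution.mono {b' : ℝ} (hx : IsSolution φ 𝒟 s b x) (hb : b' ≤ b) :
    IsSolution φ 𝒟 s b' x :=
  have hsub := Ico_subset_Ico_right hb
  fun t ht => ⟨(hx t (hsub ht)).1, (hx t (hsub ht)).2.mono hsub⟩

lemma IsSolution.exists_forall_mem (hx : IsSolution φ 𝒟 s b x) (hsb : s < b)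
    (hU : U ∈ 𝓝[𝒟] (x s)) : ∃ b' ∈ Ioc s b, ∀ t ∈ Ico s b', x t ∈ U := by
  have hs : s ∈ Ico s b := left_mem_Ico.mpr hsb
  have htendsto : Tendsto x (𝓝[Ico s b] s) (𝓝[𝒟] (x s)) :=
    tendsto_nhdsWithin_iff.mpr ⟨hx.continuousOn s hs,
      eventually_mem_nhdsWithin.mono fun t ht => (hx t ht).1⟩
  have hmem := htendsto hU
  rw [nhdsWithin_Ico_eq_nhdsGE hsb] at hmem
  obtain ⟨u, hu, hsub⟩ := mem_nhdsGE_iff_exists_Ico_subset.mp hmem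
  exact ⟨min u b, ⟨lt_min hu hsb, min_le_right u b⟩, fun t ht =>
    hsub ⟨ht.1, ht.2.trans_le (min_le_left u b)⟩⟩

lemma IsSolution.eqOn {𝒟' : Set X} (hφ : IsLipschitzOnBalls φ J) (hJ : Ico s b ⊆ J)
    (hx : IsSolution φ 𝒟 s b x) (hy : IsSolution φ 𝒟' s b y) (hxy : x s = y s) :
    EqOn x y (Ico s b) := by
  intro t ht
  have hIcc : Icc s t ⊆ Ico s b := Icc_subset_Ico_right ht.2
  have hIco : Ico s t ⊆ Ico s b := Ico_subset_Icc_self.trans hIcc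
  have hx_cont := hx.continuousOn.mono hIcc
  have hy_cont := hy.continuousOn.mono hIcc
  obtain ⟨r, hr⟩ := ((isCompact_Icc.image_of_continuousOn hx_cont).union
    (isCompact_Icc.image_of_continuousOn hy_cont)).isBounded.subset_closedBall 0
  obtain ⟨K, hK⟩ := hφ s t (hIcc.trans hJ) r
  have hr_mem {τ : ℝ} (hτ : τ ∈ Ico s t) : x τ ∈ closedBall 0 r ∧ y τ ∈ closedBall 0 r :=
    have hτ := Ico_subset_Icc_self hτ
    ⟨hr (.inl (mem_image_of_mem x hτ)), hr (.inr (mem_image_of_mem y hτ))⟩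
  exact ODE_solution_unique_of_mem_Icc_right (v := φ) (s := fun _ => closedBall 0 r)
    (fun τ hτ => hK τ (Ico_subset_Icc_self hτ))
    hx_cont (fun τ hτ => (hx.hasDerivWithinAt_Ioi (hIco hτ)).Ici_of_Ioi) (fun τ hτ => (hr_mem hτ).1)
    hy_cont (fun τ hτ => (hy.hasDerivWithinAt_Ioi (hIco hτ)).Ici_of_Ioi) (fun τ hτ => (hr_mem hτ).2)
    hxy (right_mem_Icc.mpr ht.1)

lemma IsSolution.flow_eq (hφ : IsLipschitzOnBalls φ J) (hJ : Ico s b ⊆ J)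
    (hx : IsSolution φ 𝒟 s b x) (ht : t ∈ Ico s b) : flow φ 𝒟 s t (x s) = x t := by
  have h : ∃ y : ℝ → X, (∃ b' : ℝ, t < b' ∧ IsSolution φ 𝒟 s b' y) ∧ y s = x s :=
    ⟨x, ⟨b, ht.2, hx⟩, rfl⟩
  rw [flow, dif_pos h]
  obtain ⟨⟨b', hb', hy⟩, hys⟩ := h.choose_spec
  exact (hy.mono (min_le_left b' b)).eqOn hφ ((Ico_subset_Ico_right (min_le_right b' b)).trans hJ)
    (hx.mono (min_le_right b' b)) hys ⟨ht.1, lt_min hb' ht.2⟩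

lemma exists_isSolution_univ [CompleteSpace X] {ε : ℝ} (hφ : IsLipschitzOnBalls φ J)
    (hφ_cont : ∀ x, ContinuousOn (φ · x) J) (hε : 0 < ε) (hJ : Icc s (s + ε) ⊆ J) (x₀ : X) :
    ∃ b ∈ Ioc s (s + ε), ∃ x : ℝ → X, IsSolution φ univ s b x ∧ x s = x₀ := by
  obtain ⟨K, hK⟩ := hφ s (s + ε) hJ (‖x₀‖ + 1)
  have hball : closedBall x₀ 1 ⊆ closedBall 0 (‖x₀‖ + 1) :=
    closedBall_subset_closedBall' (by simp [add_comm])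
  obtain ⟨C, hC⟩ := isCompact_Icc.exists_bound_of_continuousOn ((hφ_cont x₀).mono hJ)
  set L : ℝ≥0 := C.toNNReal + K
  have hL {t : ℝ} (ht : t ∈ Icc s (s + ε)) {x : X} (hx : x ∈ closedBall x₀ 1) : ‖φ t x‖ ≤ L := by
    have hdist : ‖φ t x - φ t x₀‖ ≤ K * 1 :=
      ((hK t ht).norm_sub_le (hball hx) (hball (mem_closedBall_self zero_le_one))).trans
        (by gcongr; exact mem_closedBall_iff_norm.mp hx)
    calc ‖φ t x‖ ≤ ‖φ t x₀‖ + ‖φ t x - φ t x₀‖ := norm_le_norm_add_norm_sub' _ _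
      _ ≤ C.toNNReal + K * 1 := by gcongr; exact (hC t ht).trans (Real.le_coe_toNNReal C)
      _ = L := by simp [L]
  set h := min ε (L + 1 : ℝ)⁻¹
  have hh : 0 < h := by positivity
  have hsub : Icc s (s + h) ⊆ Icc s (s + ε) :=
    Icc_subset_Icc_right (add_le_add_right (min_le_left _ _) s)
  have hpicard : IsPicardLindelof φ (tmin := s) (tmax := s + h)
      ⟨s, left_mem_Icc.mpr (by linarith)⟩ x₀ 1 0 L K :=
    { lipschitzOnWith := fun t ht => (hK t (hsub ht)).mono hball
      continuousOn := fun x _ => (hφ_cont x).mono (hsub.trans hJ)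
      norm_le := fun t ht x hx => hL (hsub ht) hx
      mul_max_le := by
        have : (L : ℝ) * h ≤ L * (L + 1 : ℝ)⁻¹ := by gcongr; exact min_le_right _ _
        have : (L : ℝ) * (L + 1 : ℝ)⁻¹ ≤ 1 := mul_inv_le_one_of_le₀ (by linarith) (by positivity)
        simp only [add_sub_cancel_left, sub_self, max_eq_left hh.le, NNReal.coe_one,
          NNReal.coe_zero, sub_zero]
        linarith }
  obtain ⟨x, hx₀, hx⟩ := hpicard.exists_eq_forall_mem_Icc_hasDerivWithinAt₀
  exact ⟨s + h, ⟨by linarith, by gcongr; exact min_le_left _ _⟩, x, fun t ht => ⟨mem_univ _,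
    (hx t (Ico_subset_Icc_self ht)).mono Ico_subset_Icc_self⟩, hx₀⟩

lemma exists_isSolution_of_lt_exitTime {x₀ : X} (h : (t : EReal) < exitTime φ 𝒟 U s x₀) :
    ∃ b, t < b ∧ ∃ x : ℝ → X, IsSolution φ 𝒟 s b x ∧ x s = x₀ ∧ ∀ τ ∈ Ico s b, x τ ∈ U := by
  obtain ⟨_, ⟨b, rfl, -, hx⟩, htb⟩ := lt_sSup_iff.mp h
  exact ⟨b, EReal.coe_lt_coe_iff.mp htb, hx⟩

lemma IsSolution.lt_exitTime (hx : IsSolution φ 𝒟 s b x) (hU : ∀ τ ∈ Ico s b, x τ ∈ U)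
    (ht : t ∈ Ico s b) : (t : EReal) < exitTime φ 𝒟 U s (x s) :=
  lt_sSup_iff.mpr ⟨b, ⟨b, rfl, ht.1.trans_lt ht.2, x, hx, rfl, hU⟩, EReal.coe_lt_coe_iff.mpr ht.2⟩

end Solutions

section RiccatiSolutions

open Metric

variable {𝕜 E : Type*} [RCLike 𝕜] [NormedAddCommGroup E] [InnerProductSpace 𝕜 E] [CompleteSpace E]
  {A D S : ℝ → E →L[𝕜] E} {J : Set ℝ} {s : ℝ}

lemma continuousOn_riccatiField (hA : ContinuousOn A J) (hD : ContinuousOn D J)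
    (hS : ContinuousOn S J) (P : E →L[𝕜] E) : ContinuousOn (riccatiField A D S · P) J := by
  have hA_adj : ContinuousOn (fun t => adjoint (A t)) J := hA.star
  simp only [riccatiField]
  fun_prop

lemma star_riccatiField {t : ℝ} (hD : IsSelfAdjoint (D t)) (hS : IsSelfAdjoint (S t))
    (P : E →L[𝕜] E) : star (riccatiField A D S t P) = riccatiField A D S t (star P) := by
  simp only [riccatiField, ← star_eq_adjoint, star_sub, star_add, star_mul, star_star, hD.star_eq,
    hS.star_eq, mul_assoc]
  abel

lemma norm_riccatiField_sub_le {t r : ℝ} {P Q : E →L[𝕜] E} (hP : ‖P‖ ≤ r) (hQ : ‖Q‖ ≤ r) :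
    ‖riccatiField A D S t P - riccatiField A D S t Q‖ ≤ 2 * (‖A t‖ + r * ‖S t‖) * ‖P - Q‖ := by
  have hsub : riccatiField A D S t P - riccatiField A D S t Q =
      (adjoint (A t) - P * S t) * (P - Q) + (P - Q) * (A t - S t * Q) := by
    simp only [riccatiField]
    noncomm_ring
  have hleft : ‖adjoint (A t) - P * S t‖ ≤ ‖A t‖ + r * ‖S t‖ :=
    (norm_sub_le _ _).trans (add_le_add (LinearIsometryEquiv.norm_map _ _).le
      ((norm_mul_le _ _).trans (by gcongr)))
  have hright : ‖A t - S t * Q‖ ≤ ‖A t‖ + r * ‖S t‖ :=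
    (norm_sub_le _ _).trans (add_le_add_right
      ((norm_mul_le _ _).trans (by rw [mul_comm]; gcongr)) _)
  calc _ ≤ ‖adjoint (A t) - P * S t‖ * ‖P - Q‖ + ‖P - Q‖ * ‖A t - S t * Q‖ := by
        rw [hsub]
        exact (norm_add_le _ _).trans (add_le_add (norm_mul_le _ _) (norm_mul_le _ _))
    _ ≤ (‖A t‖ + r * ‖S t‖) * ‖P - Q‖ + ‖P - Q‖ * (‖A t‖ + r * ‖S t‖) := by gcongr
    _ = 2 * (‖A t‖ + r * ‖S t‖) * ‖P - Q‖ := by ring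

lemma isLipschitzOnBalls_riccatiField (hA : ContinuousOn A J) (hS : ContinuousOn S J) :
    IsLipschitzOnBalls (riccatiField A D S) J := by
  intro a b hab r
  obtain ⟨K, hK⟩ := isCompact_Icc.exists_bound_of_continuousOn
    (f := fun t => 2 * (‖A t‖ + r * ‖S t‖)) (s := Icc a b)
    (by have := hA.mono hab; have := hS.mono hab; fun_prop)
  refine ⟨K.toNNReal, fun t ht => LipschitzOnWith.of_dist_le_mul fun P hP Q hQ => ?_⟩
  rw [dist_eq_norm, dist_eq_norm]
  exact (norm_riccatiField_sub_le (mem_closedBall_zero_iff.mp hP)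
    (mem_closedBall_zero_iff.mp hQ)).trans
      (by gcongr; exact (le_abs_self _).trans ((hK t ht).trans (Real.le_coe_toNNReal K)))

variable [NormedSpace ℝ E] [IsScalarTower ℝ 𝕜 E]

/-- The adjoint of a solution is again a solution, so symmetric data give symmetric solutions by
uniqueness. -/
lemma IsSolution.symOps_of_univ (hA : ContinuousOn A J) (hS : ContinuousOn S J)
    (hD_sym : ∀ t ∈ J, D t ∈ symOps 𝕜 E) (hS_sym : ∀ t ∈ J, S t ∈ symOps 𝕜 E)
    {b : ℝ} (hJ : Ico s b ⊆ J) {P : ℝ → E →L[𝕜] E} (hP₀ : P s ∈ symOps 𝕜 E)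
    (hP : IsSolution (riccatiField A D S) univ s b P) :
    IsSolution (riccatiField A D S) (symOps 𝕜 E) s b P := by
  have hstar : IsSolution (riccatiField A D S) univ s b (fun t => star (P t)) := fun t ht =>
    ⟨mem_univ _, star_riccatiField (hD_sym t (hJ ht)) (hS_sym t (hJ ht)) (P t) ▸ (hP t ht).2.star⟩
  exact fun t ht => ⟨hstar.eqOn (isLipschitzOnBalls_riccatiField hA hS) hJ hP hP₀ ht, (hP t ht).2⟩

lemma exists_isSolution_posInvOps (hA : ContinuousOn A J) (hD : ContinuousOn D J)
    (hS : ContinuousOn S J) (hD_sym : ∀ t ∈ J, D t ∈ symOps 𝕜 E)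
    (hS_sym : ∀ t ∈ J, S t ∈ symOps 𝕜 E) {ε : ℝ} (hε : 0 < ε) (hJ : Icc s (s + ε) ⊆ J)
    {P₀ : E →L[𝕜] E} (hP₀ : P₀ ∈ posInvOps 𝕜 E) :
    ∃ b ∈ Ioc s (s + ε), ∃ P : ℝ → E →L[𝕜] E,
      IsSolution (riccatiField A D S) (symOps 𝕜 E) s b P ∧ P s = P₀ ∧
        ∀ t ∈ Ico s b, P t ∈ posInvOps 𝕜 E := by
  obtain ⟨b, hb, P, hP, rfl⟩ := exists_isSolution_univ (isLipschitzOnBalls_riccatiField hA hS)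
    (continuousOn_riccatiField hA hD hS) hε hJ P₀
  have hJb : Ico s b ⊆ J :=
    (Ico_subset_Icc_self.trans (Icc_subset_Icc_right hb.2)).trans hJ
  have hP_sym := hP.symOps_of_univ hA hS hD_sym hS_sym hJb (isSelfAdjoint_of_mem_posInvOps hP₀)
  obtain ⟨b', hb', hP_pos⟩ := hP_sym.exists_forall_mem hb.1 (posInvOps_mem_nhdsWithin_symOps hP₀)
  exact ⟨b', ⟨hb'.1, hb'.2.trans hb.2⟩, P, hP_sym.mono hb'.2, rfl, hP_pos⟩

end RiccatiSolutions

section Comparison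

variable {𝕜 E : Type*} [RCLike 𝕜] [NormedAddCommGroup E] [InnerProductSpace 𝕜 E] [CompleteSpace E]
  [NormedSpace ℝ E] [IsScalarTower ℝ 𝕜 E]

lemma eventually_nonneg_of_hasDerivWithinAt {F : ℝ → E →L[𝕜] E} {F' : E →L[𝕜] E} {t δ : ℝ}
    (hδ : 0 < δ) (hF : HasDerivWithinAt F F' (Ioi t) t)
    (hF_adj : ∀ᶠ τ in 𝓝[>] t, IsSelfAdjoint (F τ)) (hF' : δ • 1 ≤ F')
    (hFt : F t = 0) : ∀ᶠ τ in 𝓝[>] t, 0 ≤ F τ := by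
  have hF'_adj : IsSelfAdjoint F' := .of_ge hF' (isSelfAdjoint_smul_one δ)
  filter_upwards [hF.isLittleO.def hδ, hF_adj, self_mem_nhdsWithin] with τ hsmall hadj (hτ : t < τ)
  have hh : 0 ≤ τ - t := (sub_pos.mpr hτ).le
  set T := F τ - (τ - t) • F'
  have hT_norm : ‖T‖ ≤ δ * (τ - t) := by
    simpa only [hFt, sub_zero, Real.norm_of_nonneg hh] using hsmall
  calc 0 = (τ - t) • δ • 1 + (-(δ * (τ - t))) • (1 : E →L[𝕜] E) := by module
    _ ≤ (τ - t) • F' + (-‖T‖) • 1 := by gcongr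
    _ ≤ (τ - t) • F' + T := by
      gcongr
      exact neg_norm_smul_one_le (hadj.sub (.smul (.all _) hF'_adj))
    _ = F τ := by simp only [T]; abel

/-- To first order in `h`, the congruence `(1 + h B)' V(t) (1 + h B)` is the flow of the Lyapunov
equation `V' = B' V + V B`. -/
lemma eventually_nonneg_of_lyapunov_lt {V : ℝ → E →L[𝕜] E} {V' B : E →L[𝕜] E} {t δ : ℝ}
    (hδ : 0 < δ) (hV : HasDerivWithinAt V V' (Ioi t) t)
    (hV_adj : ∀ᶠ τ in 𝓝[>] t, IsSelfAdjoint (V τ))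
    (hV' : star B * V t + V t * B + δ • 1 ≤ V') (hVt : 0 ≤ V t) :
    ∀ᶠ τ in 𝓝[>] t, 0 ≤ V τ := by
  let C : ℝ → E →L[𝕜] E := fun τ => 1 + (τ - t) • B
  have hCt : C t = 1 := by simp [C]
  have hC : HasDerivAt C B t := by
    have h := (((hasDerivAt_id t).sub_const t).smul_const B).const_add 1
    rw [one_smul] at h
    exact h
  have hcongr : HasDerivAt (fun τ => star (C τ) * V t * C τ) (star B * V t + V t * B) t := by
    have h := (hC.star.mul_const (V t)).mul hC
    rw [hCt, star_one, one_mul, mul_one] at h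
    exact h
  filter_upwards [eventually_nonneg_of_hasDerivWithinAt hδ (hV.sub hcongr.hasDerivWithinAt)
    (hV_adj.mono fun τ hτ => hτ.sub ((IsSelfAdjoint.of_nonneg hVt).conjugate' _))
    (le_sub_iff_add_le'.mpr hV') (by simp [hCt])] with τ hτ
  exact (star_left_conjugate_nonneg hVt (C τ)).trans (sub_nonneg.mp hτ)

lemma nonneg_of_lyapunov_lt {V V' B : ℝ → E →L[𝕜] E} {s b δ : ℝ} (hδ : 0 < δ)
    (hV_cont : ContinuousOn V (Icc s b)) (hV_adj : ∀ t ∈ Icc s b, IsSelfAdjoint (V t))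
    (hV : ∀ t ∈ Ico s b, HasDerivWithinAt V (V' t) (Ioi t) t)
    (hV' : ∀ t ∈ Ico s b, star (B t) * V t + V t * B t + δ • 1 ≤ V' t) (hVs : 0 ≤ V s) :
    ∀ t ∈ Icc s b, 0 ≤ V t := by
  have hclosed : IsClosed ({t | 0 ≤ V t} ∩ Icc s b) := by
    rw [inter_comm]
    exact hV_cont.preimage_isClosed_of_isClosed isClosed_Icc isClosed_Ici
  refine hclosed.Icc_subset_of_forall_mem_nhdsWithin hVs fun t ⟨hVt, ht⟩ => ?_
  have hV_adj' : ∀ᶠ τ in 𝓝[>] t, IsSelfAdjoint (V τ) := by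
    filter_upwards [Ioo_mem_nhdsGT ht.2] with τ hτ
    exact hV_adj τ ⟨ht.1.trans hτ.1.le, hτ.2.le⟩
  exact eventually_nonneg_of_lyapunov_lt hδ (hV t ht) hV_adj' (hV' t ht) hVt

lemma star_add_self_le_smul_one {B : E →L[𝕜] E} {K : ℝ} (hB : ‖B‖ ≤ K) :
    star B + B ≤ (2 * K) • 1 := by
  refine (le_norm_smul_one (.star_add_self B)).trans (smul_le_smul_of_nonneg_right ?_ zero_le_one)
  calc ‖star B + B‖ ≤ ‖star B‖ + ‖B‖ := norm_add_le _ _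
    _ ≤ 2 * K := by linarith [norm_star B]

lemma nonneg_of_lyapunov_le {V V' B : ℝ → E →L[𝕜] E} {s b K : ℝ} (hB : ∀ t ∈ Ico s b, ‖B t‖ ≤ K)
    (hV_cont : ContinuousOn V (Icc s b)) (hV_adj : ∀ t ∈ Icc s b, IsSelfAdjoint (V t))
    (hV : ∀ t ∈ Ico s b, HasDerivWithinAt V (V' t) (Ioi t) t)
    (hV' : ∀ t ∈ Ico s b, star (B t) * V t + V t * B t ≤ V' t) (hVs : 0 ≤ V s) :
    ∀ t ∈ Icc s b, 0 ≤ V t := by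
  intro t ht
  let e : ℝ → ℝ := fun τ => Real.exp ((2 * K + 1) * (τ - s))
  have he (τ : ℝ) : HasDerivAt e ((2 * K + 1) * e τ) τ := by
    simpa [e, mul_comm] using (((hasDerivAt_id τ).sub_const s).const_mul (2 * K + 1)).exp
  have hperturbed (ε : ℝ) (hε : 0 < ε) : 0 ≤ V t + (ε * e t) • 1 := by
    refine nonneg_of_lyapunov_lt (V := fun τ => V τ + (ε * e τ) • 1) (B := B) hε
      (hV_cont.add (by fun_prop)) (fun τ hτ => (hV_adj τ hτ).add (isSelfAdjoint_smul_one _))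
      (fun τ hτ => (hV τ hτ).add (((he τ).const_mul ε).smul_const (1 : E →L[𝕜] E)).hasDerivWithinAt)
      (fun τ hτ => ?_) (add_nonneg hVs (smul_nonneg (by positivity) zero_le_one)) t ht
    have hBK := star_add_self_le_smul_one (hB τ hτ)
    have hK : 0 ≤ K := (norm_nonneg _).trans (hB τ hτ)
    have hone : 1 ≤ e τ := Real.one_le_exp (mul_nonneg (by positivity) (sub_nonneg.mpr hτ.1))
    calc star (B τ) * (V τ + (ε * e τ) • 1) + (V τ + (ε * e τ) • 1) * B τ + ε • 1
        = (star (B τ) * V τ + V τ * B τ) + ((ε * e τ) • (star (B τ) + B τ) + ε • 1) := by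
          simp only [mul_add, add_mul, mul_smul_comm, smul_mul_assoc, mul_one, one_mul]
          module
      _ ≤ V' τ + ((ε * e τ) • (2 * K) • 1 + (ε * e τ) • 1) := by
          gcongr
          · exact hV' τ hτ
          · exact le_mul_of_one_le_right hε.le hone
      _ = V' τ + (ε * ((2 * K + 1) * e τ)) • 1 := by module
  have hlim : Tendsto (fun ε : ℝ => V t + (ε * e t) • (1 : E →L[𝕜] E)) (𝓝[>] 0) (𝓝 (V t)) := by
    refine (Continuous.tendsto' ?_ 0 _ (by simp)).mono_left nhdsWithin_le_nhds
    fun_prop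
  exact ge_of_tendsto hlim (eventually_mem_nhdsWithin.mono hperturbed)

variable {A D S : ℝ → E →L[𝕜] E}

lemma riccatiField_sub_riccatiField {t : ℝ} (hS : IsSelfAdjoint (S t)) {P Q : E →L[𝕜] E}
    (hP : IsSelfAdjoint P) (hQ : IsSelfAdjoint Q) :
    riccatiField A D S t Q - riccatiField A D S t P =
      star (A t - (2⁻¹ : ℝ) • (S t * (Q + P))) * (Q - P) +
        (Q - P) * (A t - (2⁻¹ : ℝ) • (S t * (Q + P))) := by
  simp only [riccatiField, ← star_eq_adjoint, star_sub, star_smul, star_mul, star_add, hS.star_eq,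
    hP.star_eq, hQ.star_eq, star_trivial, sub_mul, mul_sub, add_mul, mul_add, smul_mul_assoc,
    mul_smul_comm, mul_assoc]
  module

lemma IsSolution.le_of_supersolution {s b t : ℝ} (hA : ContinuousOn A (Ico s b))
    (hS : ContinuousOn S (Ico s b)) (hS_sym : ∀ t ∈ Ico s b, S t ∈ symOps 𝕜 E)
    {P Q Q' : ℝ → E →L[𝕜] E} (hP : IsSolution (riccatiField A D S) (symOps 𝕜 E) s b P)
    (hQ_adj : ∀ t ∈ Ico s b, Q t ∈ symOps 𝕜 E)
    (hQ : ∀ t ∈ Ico s b, HasDerivWithinAt Q (Q' t) (Ico s b) t)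
    (hQ' : ∀ t ∈ Ico s b, riccatiField A D S t (Q t) ≤ Q' t) (hPQ : P s ≤ Q s)
    (ht : t ∈ Ico s b) : P t ≤ Q t := by
  have hIcc : Icc s t ⊆ Ico s b := Icc_subset_Ico_right ht.2
  have hIco : Ico s t ⊆ Ico s b := Ico_subset_Icc_self.trans hIcc
  have hQ_cont : ContinuousOn Q (Ico s b) := fun τ hτ => (hQ τ hτ).continuousWithinAt
  let B : ℝ → E →L[𝕜] E := fun τ => A τ - (2⁻¹ : ℝ) • (S τ * (Q τ + P τ))
  have hP_cont := hP.continuousOn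
  have hB_cont : ContinuousOn B (Icc s t) := ContinuousOn.mono (by fun_prop) hIcc
  obtain ⟨K, hK⟩ := isCompact_Icc.exists_bound_of_continuousOn hB_cont
  have hderiv : ∀ τ ∈ Ico s t, HasDerivWithinAt (fun τ => Q τ - P τ)
      (Q' τ - riccatiField A D S τ (P τ)) (Ioi τ) τ := fun τ hτ =>
    (hasDerivWithinAt_Ioi_of_Ico (hIco hτ) (hQ τ (hIco hτ))).sub
      (hP.hasDerivWithinAt_Ioi (hIco hτ))
  have hadj : ∀ τ ∈ Icc s t, IsSelfAdjoint (Q τ - P τ) := fun τ hτ =>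
    (hQ_adj τ (hIcc hτ)).sub (hP τ (hIcc hτ)).1
  have hlower : ∀ τ ∈ Ico s t, star (B τ) * (Q τ - P τ) + (Q τ - P τ) * B τ ≤
      Q' τ - riccatiField A D S τ (P τ) := fun τ hτ => by
    have hτ := hIco hτ
    rw [← riccatiField_sub_riccatiField (D := D) (hS_sym τ hτ) (hP τ hτ).1 (hQ_adj τ hτ)]
    exact sub_le_sub_right (hQ' τ hτ) _
  exact sub_nonneg.mp (nonneg_of_lyapunov_le (fun τ hτ => hK τ (Ico_subset_Icc_self hτ))
    ((hQ_cont.sub hP_cont).mono hIcc) hadj hderiv hlower (sub_nonneg.mpr hPQ) t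
    (right_mem_Icc.mpr ht.1))

end Comparison

section LogarithmicInequality

variable {X : Type*} [NormedAddCommGroup X] [NormedSpace ℝ X] [PartialOrder X]
  [IsOrderedAddMonoid X] [IsOrderedModule ℝ X] [OrderClosedTopology X]

lemma le_of_forall_hasDerivAt_of_nonneg [CompleteSpace X] {f f' : ℝ → X} {a b : ℝ} (hab : a ≤ b)
    (hf : ∀ t ∈ Icc a b, HasDerivAt f (f' t) t) (hf'_cont : ContinuousOn f' (Icc a b))
    (hf' : ∀ t ∈ Icc a b, 0 ≤ f' t) : f a ≤ f b := by
  rw [← uIcc_of_le hab] at hf hf'_cont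
  rw [← sub_nonneg, ← intervalIntegral.integral_eq_sub_of_hasDerivAt hf
    hf'_cont.intervalIntegrable, intervalIntegral.integral_of_le hab]
  exact MeasureTheory.integral_nonneg_of_ae ((MeasureTheory.ae_restrict_mem measurableSet_Ioc).mono
    fun t ht => hf' t (Ioc_subset_Icc_self ht))

/-- Divide the hypothesis by `τ ^ 2` and integrate it from `1` to `c`. -/
lemma mul_log_smul_le_of_forall_smul_le [CompleteSpace X] {a b p : X} {β c : ℝ} (hc : 1 ≤ c)
    (h : ∀ τ ∈ Icc 1 c, (β * τ) • p ≤ τ ^ 2 • b + a) :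
    (β * (c * Real.log c)) • p ≤ (c - 1) • (a + c • b) := by
  have hpos {τ : ℝ} (hτ : τ ∈ Icc 1 c) : 0 < τ := zero_lt_one.trans_le hτ.1
  let f : ℝ → X := fun τ => τ • b - τ⁻¹ • a - Real.log τ • β • p
  have hf : ∀ τ ∈ Icc 1 c, HasDerivAt f ((1 : ℝ) • b - (-(τ ^ 2)⁻¹) • a - τ⁻¹ • β • p) τ :=
    fun τ hτ => (((hasDerivAt_id τ).smul_const b).sub
      ((hasDerivAt_inv (hpos hτ).ne').smul_const a)).sub
        ((Real.hasDerivAt_log (hpos hτ).ne').smul_const (β • p))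
  have hf_le : f 1 ≤ f c := by
    refine le_of_forall_hasDerivAt_of_nonneg hc hf ?_ fun τ hτ => ?_
    · have hne : ∀ τ ∈ Icc 1 c, τ ≠ 0 := fun τ hτ => (hpos hτ).ne'
      have hne_sq : ∀ τ ∈ Icc 1 c, τ ^ 2 ≠ 0 := fun τ hτ => pow_ne_zero 2 (hne τ hτ)
      fun_prop (disch := assumption)
    · have hτ₀ := (hpos hτ).ne'
      calc 0 ≤ (τ ^ 2)⁻¹ • (τ ^ 2 • b + a - (β * τ) • p) :=
            smul_nonneg (by positivity) (sub_nonneg.mpr (h τ hτ))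
        _ = (1 : ℝ) • b - (-(τ ^ 2)⁻¹) • a - τ⁻¹ • β • p := by
          match_scalars <;> field_simp
  have hc₀ : 0 < c := zero_lt_one.trans_le hc
  rw [← sub_nonneg]
  calc 0 ≤ c • (f c - f 1) := smul_nonneg hc₀.le (sub_nonneg.mpr hf_le)
    _ = (c - 1) • (a + c • b) - (β * (c * Real.log c)) • p := by
      simp only [f, Real.log_one]
      match_scalars <;> field_simp <;> ring

lemma smul_le_of_forall_mul_log_smul_le {a b p : X} {β : ℝ}
    (h : ∀ c > 1, (β * (c * Real.log c)) • p ≤ (c - 1) • (a + c • b)) : β • p ≤ a + b := by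
  have hleft : HasDerivAt (fun c : ℝ => (β * (c * Real.log c)) • p)
      ((β * (1 * Real.log 1 + 1 * (1 : ℝ)⁻¹)) • p) 1 :=
    (((hasDerivAt_id (1 : ℝ)).mul (Real.hasDerivAt_log one_ne_zero)).const_mul β).smul_const p
  have hright : HasDerivAt (fun c : ℝ => (c - 1) • (a + c • b))
      ((1 - 1 : ℝ) • (1 : ℝ) • b + (1 : ℝ) • (a + (1 : ℝ) • b)) 1 :=
    ((hasDerivAt_id (1 : ℝ)).sub_const 1).smul
      (((hasDerivAt_id (1 : ℝ)).smul_const b).const_add a)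
  have hle := hasDerivWithinAt_Ioi_le_of_eventually_le hleft.hasDerivWithinAt
    hright.hasDerivWithinAt (by simp) (eventually_mem_nhdsWithin.mono h)
  simpa using hle

end LogarithmicInequality

section ContractionRate

lemma hasDerivAt_exp_exp_mul (β s d t : ℝ) :
    HasDerivAt (fun t => Real.exp (Real.exp (-β * (t - s)) * d))
      (-(β * (Real.exp (Real.exp (-β * (t - s)) * d) * (Real.exp (-β * (t - s)) * d)))) t := by
  have hinner : HasDerivAt (fun t => -β * (t - s)) (-β * 1) t :=
    ((hasDerivAt_id t).sub_const s).const_mul (-β)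
  convert (hinner.exp.mul_const d).exp using 1
  ring

variable {𝕜 E : Type*} [RCLike 𝕜] [NormedAddCommGroup E] [InnerProductSpace 𝕜 E] [CompleteSpace E]
  [NormedSpace ℝ E] [IsScalarTower ℝ 𝕜 E] {A D S : ℝ → E →L[𝕜] E}

lemma riccatiField_smul (c t : ℝ) (P : E →L[𝕜] E) :
    riccatiField A D S t (c • P) =
      c • riccatiField A D S t P - (c - 1) • (D t + c • (P * S t * P)) := by
  simp only [riccatiField, mul_smul_comm, smul_mul_assoc]
  module

/-- The right-hand side is a supersolution. -/
lemma IsSolution.le_exp_smul {β s b d t : ℝ} (hβ : β ∈ riccatiRates D S) (hs : 0 ≤ s)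
    (hA : ContinuousOn A (Ici 0)) (hS : ContinuousOn S (Ici 0))
    (hS_sym : ∀ t ∈ Ici 0, S t ∈ symOps 𝕜 E) {P Q : ℝ → E →L[𝕜] E}
    (hP : IsSolution (riccatiField A D S) (symOps 𝕜 E) s b P)
    (hQ : IsSolution (riccatiField A D S) (symOps 𝕜 E) s b Q)
    (hQ_pos : ∀ t ∈ Ico s b, Q t ∈ posInvOps 𝕜 E) (hd : 0 ≤ d) (hPQ : P s ≤ Real.exp d • Q s)
    (ht : t ∈ Ico s b) : P t ≤ Real.exp (Real.exp (-β * (t - s)) * d) • Q t := by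
  have hsub : Ico s b ⊆ Ici 0 := fun τ hτ => hs.trans hτ.1
  refine hP.le_of_supersolution (Q := fun τ => Real.exp (Real.exp (-β * (τ - s)) * d) • Q τ)
    (hA.mono hsub) (hS.mono hsub) (fun τ hτ => hS_sym τ (hsub hτ))
    (fun τ hτ => (IsSelfAdjoint.all _).smul (hQ τ hτ).1)
    (fun τ hτ => (hasDerivAt_exp_exp_mul β s d τ).hasDerivWithinAt.smul (hQ τ hτ).2)
    (fun τ hτ => ?_) (by simpa using hPQ) ht
  set l := Real.exp (-β * (τ - s)) * d
  have hlog := mul_log_smul_le_of_forall_smul_le (a := D τ) (b := Q τ * S τ * Q τ)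
    (Real.one_le_exp (by positivity : 0 ≤ l)) fun c hc => by
      have hrate := hβ τ (hsub hτ) _
        (smul_mem_posInvOps (hQ_pos τ hτ) (zero_lt_one.trans_le hc.1))
      simpa only [smul_mul_assoc, mul_smul_comm, smul_smul, sq] using hrate
  rw [Real.log_exp] at hlog
  rw [riccatiField_smul, neg_smul, ← sub_eq_add_neg]
  exact sub_le_sub_left hlog _

variable [Nontrivial E]

lemma thompsonDist_le_iff_of_mem_posInvOps {P Q : E →L[𝕜] E} (hP : P ∈ posInvOps 𝕜 E)
    (hQ : Q ∈ posInvOps 𝕜 E) {r : ℝ} :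
    thompsonDist P Q ≤ r ↔ P ≤ Real.exp r • Q ∧ Q ≤ Real.exp r • P :=
  thompsonDist_le_iff (pos_of_mem_posInvOps hP) (pos_of_mem_posInvOps hQ)
    (exists_le_smul_of_mem_posInvOps (isSelfAdjoint_of_mem_posInvOps hP) hQ)
    (exists_le_smul_of_mem_posInvOps (isSelfAdjoint_of_mem_posInvOps hQ) hP)

lemma thompsonDist_nonneg_of_mem_posInvOps {P Q : E →L[𝕜] E} (hP : P ∈ posInvOps 𝕜 E)
    (hQ : Q ∈ posInvOps 𝕜 E) : 0 ≤ thompsonDist P Q :=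
  thompsonDist_nonneg (pos_of_mem_posInvOps hP) (pos_of_mem_posInvOps hQ)
    (exists_le_smul_of_mem_posInvOps (isSelfAdjoint_of_mem_posInvOps hP) hQ)
    (exists_le_smul_of_mem_posInvOps (isSelfAdjoint_of_mem_posInvOps hQ) hP)

lemma contractsAtRate_of_mem_riccatiRates {β : ℝ} (hβ : β ∈ riccatiRates D S)
    (hA : ContinuousOn A (Ici 0)) (hS : ContinuousOn S (Ici 0))
    (hS_sym : ∀ t ∈ Ici 0, S t ∈ symOps 𝕜 E) :
    ContractsAtRate (riccatiField A D S) (symOps 𝕜 E) (posInvOps 𝕜 E) β := by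
  intro P₁ hP₁ P₂ hP₂ s t hs hst ht
  obtain ⟨b₁, htb₁, x₁, hx₁, rfl, hx₁_pos⟩ := exists_isSolution_of_lt_exitTime (lt_min_iff.mp ht).1
  obtain ⟨b₂, htb₂, x₂, hx₂, rfl, hx₂_pos⟩ := exists_isSolution_of_lt_exitTime (lt_min_iff.mp ht).2
  have hLip := isLipschitzOnBalls_riccatiField (D := D) hA hS
  have hIco {b : ℝ} : Ico s b ⊆ Ici 0 := fun τ hτ => hs.trans hτ.1
  rw [hx₁.flow_eq hLip hIco ⟨hst, htb₁⟩, hx₂.flow_eq hLip hIco ⟨hst, htb₂⟩,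
    thompsonDist_le_iff_of_mem_posInvOps (hx₁_pos t ⟨hst, htb₁⟩) (hx₂_pos t ⟨hst, htb₂⟩)]
  obtain ⟨hle₁, hle₂⟩ := (thompsonDist_le_iff_of_mem_posInvOps hP₁ hP₂).mp le_rfl
  have hd := thompsonDist_nonneg_of_mem_posInvOps hP₁ hP₂
  have hb₁ := min_le_left b₁ b₂
  have hb₂ := min_le_right b₁ b₂
  have htb : t ∈ Ico s (min b₁ b₂) := ⟨hst, lt_min htb₁ htb₂⟩
  exact ⟨(hx₁.mono hb₁).le_exp_smul hβ hs hA hS hS_sym (hx₂.mono hb₂)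
      (fun τ hτ => hx₂_pos τ (Ico_subset_Ico_right hb₂ hτ)) hd hle₁ htb,
    (hx₂.mono hb₂).le_exp_smul hβ hs hA hS hS_sym (hx₁.mono hb₁)
      (fun τ hτ => hx₁_pos τ (Ico_subset_Ico_right hb₁ hτ)) hd hle₂ htb⟩

lemma ContractsAtRate.le_exp_smul {φ : ℝ → (E →L[𝕜] E) → E →L[𝕜] E} {α s b c t : ℝ}
    (hα : ContractsAtRate φ (symOps 𝕜 E) (posInvOps 𝕜 E) α) (hs : 0 ≤ s)
    (hφ : IsLipschitzOnBalls φ (Ici 0)) {P Q : ℝ → E →L[𝕜] E}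
    (hP : IsSolution φ (symOps 𝕜 E) s b P) (hP_pos : ∀ t ∈ Ico s b, P t ∈ posInvOps 𝕜 E)
    (hQ : IsSolution φ (symOps 𝕜 E) s b Q) (hQ_pos : ∀ t ∈ Ico s b, Q t ∈ posInvOps 𝕜 E)
    (hc : 1 ≤ c) (hPQ : P s = c • Q s) (ht : t ∈ Ico s b) :
    P t ≤ Real.exp (Real.exp (-α * (t - s)) * Real.log c) • Q t := by
  have hIco : Ico s b ⊆ Ici 0 := fun τ hτ => hs.trans hτ.1
  have hs_mem : s ∈ Ico s b := left_mem_Ico.mpr (ht.1.trans_lt ht.2)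
  have hdist := hα (P s) (hP_pos s hs_mem) (Q s) (hQ_pos s hs_mem) s t hs ht.1
    (lt_min (hP.lt_exitTime hP_pos ht) (hQ.lt_exitTime hQ_pos ht))
  rw [hP.flow_eq hφ hIco ht, hQ.flow_eq hφ hIco ht, hPQ] at hdist
  refine ((thompsonDist_le_iff_of_mem_posInvOps (hP_pos t ht) (hQ_pos t ht)).mp
    (hdist.trans ?_)).1
  gcongr
  exact thompsonDist_smul_self_le (pos_of_mem_posInvOps (hQ_pos s hs_mem)) hc

/-- Differentiate the contraction estimate for the solutions starting from `c • P` and `P` at the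
initial time, and then at `c = 1`. -/
lemma mem_riccatiRates_of_contractsAtRate {α : ℝ}
    (hα : ContractsAtRate (riccatiField A D S) (symOps 𝕜 E) (posInvOps 𝕜 E) α)
    (hA : ContinuousOn A (Ici 0)) (hD : ContinuousOn D (Ici 0)) (hS : ContinuousOn S (Ici 0))
    (hD_sym : ∀ t ∈ Ici 0, D t ∈ symOps 𝕜 E) (hS_sym : ∀ t ∈ Ici 0, S t ∈ symOps 𝕜 E) :
    α ∈ riccatiRates D S := by
  intro s hs P hP
  refine (smul_le_of_forall_mul_log_smul_le (X := E →L[𝕜] E) (a := D s) fun c hc => ?_).trans_eq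
    (add_comm _ _)
  have hc₀ : 0 < c := zero_lt_one.trans hc
  have hexists {P₀ : E →L[𝕜] E} (hP₀ : P₀ ∈ posInvOps 𝕜 E) :=
    exists_isSolution_posInvOps hA hD hS hD_sym hS_sym one_pos
      (fun τ hτ => hs.trans hτ.1 : Icc s (s + 1) ⊆ Ici 0) hP₀
  obtain ⟨b₁, hb₁, x₁, hx₁, hx₁s, hx₁_pos⟩ := hexists (smul_mem_posInvOps hP hc₀)
  obtain ⟨b₂, hb₂, x₂, hx₂, rfl, hx₂_pos⟩ := hexists hP
  have hb : s < min b₁ b₂ := lt_min hb₁.1 hb₂.1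
  have hle : ∀ t ∈ Ico s (min b₁ b₂),
      x₁ t ≤ Real.exp (Real.exp (-α * (t - s)) * Real.log c) • x₂ t := fun t ht =>
    hα.le_exp_smul hs (isLipschitzOnBalls_riccatiField hA hS)
      (hx₁.mono (min_le_left b₁ b₂))
      (fun τ hτ => hx₁_pos τ (Ico_subset_Ico_right (min_le_left b₁ b₂) hτ))
      (hx₂.mono (min_le_right b₁ b₂))
      (fun τ hτ => hx₂_pos τ (Ico_subset_Ico_right (min_le_right b₁ b₂) hτ)) hc.le hx₁s ht
  have hderiv := hasDerivWithinAt_Ioi_le_of_eventually_le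
    (g := fun t => Real.exp (Real.exp (-α * (t - s)) * Real.log c) • x₂ t)
    (hx₁.hasDerivWithinAt_Ioi (left_mem_Ico.mpr hb₁.1))
    ((hasDerivAt_exp_exp_mul α s (Real.log c) s).hasDerivWithinAt.smul
      (hx₂.hasDerivWithinAt_Ioi (left_mem_Ico.mpr hb₂.1)))
    (by simp [hx₁s, Real.exp_log hc₀])
    (mem_of_superset (Ioo_mem_nhdsGT hb) fun t ht => hle t ⟨ht.1.le, ht.2⟩)
  simp only [sub_self, mul_zero, Real.exp_zero, one_mul, Real.exp_log hc₀, hx₁s, riccatiField_smul,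
    neg_smul, ← sub_eq_add_neg] at hderiv
  exact (sub_le_sub_iff_left _).mp hderiv

lemma setOf_contractsAtRate_eq_riccatiRates
    (hA : ContinuousOn A (Ici 0)) (hD : ContinuousOn D (Ici 0)) (hS : ContinuousOn S (Ici 0))
    (hD_sym : ∀ t ∈ Ici 0, D t ∈ symOps 𝕜 E) (hS_sym : ∀ t ∈ Ici 0, S t ∈ symOps 𝕜 E) :
    {α : ℝ | ContractsAtRate (riccatiField A D S) (symOps 𝕜 E) (posInvOps 𝕜 E) α} =
      riccatiRates D S :=
  Subset.antisymm (fun _ hα => mem_riccatiRates_of_contractsAtRate hα hA hD hS hD_sym hS_sym)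
    fun _ hβ => contractsAtRate_of_mem_riccatiRates hβ hA hS hS_sym

end ContractionRate

section RiccatiRates

variable {𝕜 E : Type*} [RCLike 𝕜] [NormedAddCommGroup E] [InnerProductSpace 𝕜 E] [CompleteSpace E]
  [NormedSpace ℝ E] [IsScalarTower ℝ 𝕜 E] {D S : ℝ → E →L[𝕜] E}

lemma isClosed_riccatiRates : IsClosed (riccatiRates D S) := by
  simp only [riccatiRates, ofPred_forall]
  exact isClosed_iInter fun t => isClosed_iInter fun _ => isClosed_biInter fun P _ =>
    isClosed_le (by fun_prop) continuous_const

lemma bddAbove_riccatiRates [Nontrivial E] (hD : D 0 ∈ symOps 𝕜 E) (hS : S 0 ∈ symOps 𝕜 E) :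
    BddAbove (riccatiRates D S) := by
  obtain ⟨b, hb⟩ := exists_le_smul_of_mem_posInvOps (IsSelfAdjoint.add hS hD)
    (one_mem_posInvOps (𝕜 := 𝕜) (E := E))
  refine ⟨b, fun β hβ => le_of_smul_le_smul_right ?_
    (pos_of_mem_posInvOps (one_mem_posInvOps (𝕜 := 𝕜) (E := E)))⟩
  exact (hβ 0 le_rfl 1 one_mem_posInvOps).trans (by simpa only [one_mul, mul_one] using hb)

lemma isGreatest_sSup_riccatiRates [Nontrivial E] (hD : D 0 ∈ symOps 𝕜 E) (hS : S 0 ∈ symOps 𝕜 E)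
    (hne : (riccatiRates D S).Nonempty) :
    IsGreatest (riccatiRates D S) (sSup (riccatiRates D S)) :=
  isClosed_riccatiRates.isGreatest_csSup hne (bddAbove_riccatiRates hD hS)

end RiccatiRates

lemma sSup_coe_image_of_isGreatest {s : Set ℝ} {m : ℝ} (h : IsGreatest s m) :
    sSup ((fun x : ℝ => (x : EReal)) '' s) = (m : EReal) :=
  (EReal.coe_strictMono.monotone.map_isGreatest h).isLUB.sSup_eq

section ExplicitFormula

variable {𝕜 E : Type*} [RCLike 𝕜] [NormedAddCommGroup E] [InnerProductSpace 𝕜 E] [CompleteSpace E]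
  [NormedSpace ℝ E] [IsScalarTower ℝ 𝕜 E]

/-- Completing the square, `R (P R² P + D - 2γ P) R = (R P R - γ)² + (R D R - γ²)`; the congruence
by `R` is cancelled by the right inverse `D R (R D R)⁻¹` of `R`. -/
lemma smul_le_mul_mul_add_of_sq_smul_one_le {R D P : E →L[𝕜] E} {γ : ℝ} (hR : IsSelfAdjoint R)
    (hP : IsSelfAdjoint P) (hγ : 0 < γ) (h : γ ^ 2 • 1 ≤ R * D * R) :
    (2 * γ) • P ≤ P * (R * R) * P + D := by
  obtain ⟨U, hU⟩ := (mem_posInvOps_iff.mpr ⟨γ ^ 2, by positivity, h⟩).2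
  set V := D * R * ↑U⁻¹
  have hRV : R * V = 1 := by rw [← U.mul_inv, hU, ← mul_assoc, ← mul_assoc]
  have hVR : star V * R = 1 := by rw [← hR.star_eq, ← star_mul, hRV, star_one]
  have hsq : 0 ≤ R * (P * (R * R) * P + D - (2 * γ) • P) * R := by
    have hadj : IsSelfAdjoint (R * P * R - γ • 1) := by
      refine .sub ?_ (isSelfAdjoint_smul_one γ)
      simpa only [hR.star_eq] using hP.conjugate R
    calc 0 ≤ (R * P * R - γ • 1) * (R * P * R - γ • 1) + (R * D * R - γ ^ 2 • 1) :=
          add_nonneg hadj.mul_self_nonneg (sub_nonneg.mpr h)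
      _ = R * (P * (R * R) * P + D - (2 * γ) • P) * R := by
        simp only [mul_add, add_mul, mul_sub, sub_mul, mul_smul_comm, smul_mul_assoc, mul_one,
          one_mul, mul_assoc]
        module
  rw [← sub_nonneg]
  calc 0 ≤ star V * (R * (P * (R * R) * P + D - (2 * γ) • P) * R) * V :=
        star_left_conjugate_nonneg hsq V
    _ = (star V * R) * (P * (R * R) * P + D - (2 * γ) • P) * (R * V) := by
      simp only [mul_assoc]
    _ = P * (R * R) * P + D - (2 * γ) • P := by rw [hVR, hRV, one_mul, mul_one]

/-- Apply the hypothesis to `P = γ C⁻²` and conjugate by `C`. -/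
lemma sq_smul_one_le_conjugate_of_forall_smul_le {C D S : E →L[𝕜] E} {γ : ℝ}
    (hC : C ∈ posInvOps 𝕜 E) (hSC : S ≤ C * C) (hγ : 0 < γ)
    (h : ∀ P ∈ posInvOps 𝕜 E, (2 * γ) • P ≤ P * S * P + D) : γ ^ 2 • 1 ≤ C * D * C := by
  have hC_adj := isSelfAdjoint_of_mem_posInvOps hC
  obtain ⟨U, rfl⟩ := hC.2
  set W : E →L[𝕜] E := ↑U⁻¹
  have hUW : (U : E →L[𝕜] E) * W = 1 := U.mul_inv
  have hWU : W * (U : E →L[𝕜] E) = 1 := U.inv_mul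
  have hW_adj : IsSelfAdjoint W :=
    left_inv_eq_right_inv (by rw [← hC_adj.star_eq, ← star_mul, hUW, star_one]) hUW
  have hWSW : W * S * W ≤ 1 := by
    calc W * S * W ≤ W * (U * U) * W := hW_adj.conjugate_le_conjugate hSC
      _ = (W * U) * (U * W) := by simp only [mul_assoc]
      _ = 1 := by rw [hWU, hUW, one_mul]
  have hWW : W * W ∈ posInvOps 𝕜 E :=
    ⟨(nonneg_iff_isPositive _).mp hW_adj.mul_self_nonneg, U⁻¹.isUnit.mul U⁻¹.isUnit⟩
  have hconj := hC_adj.conjugate_le_conjugate (h _ (smul_mem_posInvOps hWW hγ))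
  have hleft : (U : E →L[𝕜] E) * (2 * γ) • γ • (W * W) * U = (2 * γ ^ 2) • 1 := by
    calc (U : E →L[𝕜] E) * (2 * γ) • γ • (W * W) * U = (2 * γ ^ 2) • ((U * W) * (W * U)) := by
          simp only [mul_smul_comm, smul_mul_assoc, mul_assoc]
          module
      _ = (2 * γ ^ 2) • 1 := by rw [hUW, hWU, one_mul]
  have hright : (U : E →L[𝕜] E) * (γ • (W * W) * S * γ • (W * W) + D) * U =
      γ ^ 2 • (W * S * W) + U * D * U := by
    calc _ = γ ^ 2 • ((U * W) * (W * S * W) * (W * U)) + U * D * U := by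
          simp only [mul_add, add_mul, mul_smul_comm, smul_mul_assoc, mul_assoc]
          module
      _ = γ ^ 2 • (W * S * W) + U * D * U := by rw [hUW, hWU, one_mul, mul_one]
  rw [hleft, hright] at hconj
  calc γ ^ 2 • (1 : E →L[𝕜] E) = (2 * γ ^ 2) • 1 - γ ^ 2 • 1 := by module
    _ ≤ γ ^ 2 • (W * S * W) + U * D * U - γ ^ 2 • (W * S * W) := by gcongr
    _ = U * D * U := add_sub_cancel_left _ _

lemma sq_smul_one_le_of_forall_smul_le_mul_mul_add {R D : E →L[𝕜] E} {γ : ℝ} (hR : 0 ≤ R)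
    (hγ : 0 < γ) (h : ∀ P ∈ posInvOps 𝕜 E, (2 * γ) • P ≤ P * (R * R) * P + D) :
    γ ^ 2 • 1 ≤ R * D * R := by
  have hle : ∀ δ > (0 : ℝ), γ ^ 2 • 1 ≤ (R + δ • 1) * D * (R + δ • 1) := by
    intro δ hδ
    refine sq_smul_one_le_conjugate_of_forall_smul_le
      (mem_posInvOps_iff.mpr ⟨δ, hδ, le_add_of_nonneg_left hR⟩) ?_ hγ h
    calc R * R ≤ R * R + ((2 * δ) • R + (δ * δ) • 1) :=
          le_add_of_nonneg_right (add_nonneg (smul_nonneg (by positivity) hR)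
            (smul_nonneg (by positivity) zero_le_one))
      _ = (R + δ • 1) * (R + δ • 1) := by
        simp only [mul_add, add_mul, mul_smul_comm, smul_mul_assoc, mul_one, one_mul]
        module
  have hlim : Tendsto (fun δ : ℝ => (R + δ • 1) * D * (R + δ • 1)) (𝓝[>] 0) (𝓝 (R * D * R)) := by
    refine tendsto_nhdsWithin_of_tendsto_nhds (Continuous.tendsto' (by fun_prop) _ _ ?_)
    simp only [zero_smul, add_zero]
  exact ge_of_tendsto hlim (eventually_mem_nhdsWithin.mono hle)

lemma forall_smul_le_mul_mul_add_iff [Nontrivial E] {D S : E →L[𝕜] E} (hD : 0 ≤ D) (hS : 0 ≤ S)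
    {β : ℝ} :
    (∀ P ∈ posInvOps 𝕜 E, β • P ≤ P * S * P + D) ↔
      β ≤ 2 * √(lowerRatio (opSqrt S * D * opSqrt S) 1) := by
  obtain ⟨hR, hRS⟩ := opSqrt_spec hS
  set R := opSqrt S
  have hR_adj : IsSelfAdjoint R := .of_nonneg hR
  have hRDR : IsSelfAdjoint (R * D * R) := .of_nonneg (hR_adj.conjugate_nonneg hD)
  have hone : (1 : E →L[𝕜] E) ∈ posInvOps 𝕜 E := one_mem_posInvOps
  rcases le_or_gt β 0 with hβ | hβ
  · refine iff_of_true (fun P hP => ?_) (hβ.trans (by positivity))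
    have hP₀ := nonneg_of_mem_posInvOps hP
    calc β • P ≤ 0 := smul_nonpos_of_nonpos_of_nonneg hβ hP₀
      _ ≤ P * S * P + D := add_nonneg ((isSelfAdjoint_of_mem_posInvOps hP).conjugate_nonneg hS) hD
  · rw [← div_le_iff₀' two_pos, Real.le_sqrt' (half_pos hβ),
      le_lowerRatio_iff (pos_of_mem_posInvOps hone) (exists_smul_le_of_mem_posInvOps hRDR hone)
        (exists_le_smul_of_mem_posInvOps hRDR hone), ← hRS]
    have hβ₂ : 2 * (β / 2) = β := mul_div_cancel₀ β two_ne_zero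
    nth_rw 1 [← hβ₂]
    exact ⟨fun h => sq_smul_one_le_of_forall_smul_le_mul_mul_add hR (half_pos hβ) h,
      fun h P hP => smul_le_mul_mul_add_of_sq_smul_one_le hR_adj (isSelfAdjoint_of_mem_posInvOps hP)
        (half_pos hβ) h⟩

lemma riccatiRates_eq_Iic [Nontrivial E] {D S : ℝ → E →L[𝕜] E}
    (hD : ∀ t ∈ Ici 0, 0 ≤ D t) (hS : ∀ t ∈ Ici 0, 0 ≤ S t) :
    riccatiRates D S =
      Iic (2 * ⨅ t : Ici (0 : ℝ), √(lowerRatio (opSqrt (S t) * D t * opSqrt (S t)) 1)) := by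
  have hbdd : BddBelow (range fun t : Ici (0 : ℝ) =>
      √(lowerRatio (opSqrt (S t) * D t * opSqrt (S t)) 1)) :=
    ⟨0, forall_mem_range.mpr fun t => Real.sqrt_nonneg _⟩
  ext β
  rw [mem_Iic, ← div_le_iff₀' two_pos, le_ciInf_iff hbdd, Subtype.forall]
  refine forall₂_congr fun t ht => ?_
  rw [forall_smul_le_mul_mul_add_iff (hD t ht) (hS t ht), div_le_iff₀' two_pos]

end ExplicitFormula

end Riccati

end

open Set Riccati ContinuousLinearMap in
theorem mainTheorem10_general {𝕜 E : Type*} [RCLike 𝕜] [NormedAddCommGroup E]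
    [InnerProductSpace 𝕜 E] [CompleteSpace E] [Nontrivial E] [NormedSpace ℝ E]
    [IsScalarTower ℝ 𝕜 E] (A D S : ℝ → E →L[𝕜] E)
    (hA : ContinuousOn A (Ici 0)) (hD : ContinuousOn D (Ici 0)) (hS : ContinuousOn S (Ici 0))
    (hD_sym : ∀ t ∈ Ici 0, D t ∈ symOps 𝕜 E) (hS_sym : ∀ t ∈ Ici 0, S t ∈ symOps 𝕜 E) :
    bestContractionRate (riccatiField A D S) (symOps 𝕜 E) (posInvOps 𝕜 E) =
      sSup ((fun β : ℝ => (β : EReal)) '' riccatiRates D S) ∧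
    ((riccatiRates D S).Nonempty →
      IsGreatest {α : ℝ | ContractsAtRate (riccatiField A D S) (symOps 𝕜 E) (posInvOps 𝕜 E) α}
        (sSup (riccatiRates D S))) ∧
    ((∀ t, 0 ≤ t → (D t).IsPositive ∧ (S t).IsPositive) →
      bestContractionRate (riccatiField A D S) (symOps 𝕜 E) (posInvOps 𝕜 E) =
        ((2 * ⨅ t : Ici (0 : ℝ),
          √(lowerRatio (opSqrt (S t) * D t * opSqrt (S t)) (1 : E →L[𝕜] E)) : ℝ) : EReal) ∧
      IsGreatest {α : ℝ | ContractsAtRate (riccatiField A D S) (symOps 𝕜 E) (posInvOps 𝕜 E) α}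
        (2 * ⨅ t : Ici (0 : ℝ),
          √(lowerRatio (opSqrt (S t) * D t * opSqrt (S t)) (1 : E →L[𝕜] E)))) := by
  rw [bestContractionRate, setOf_contractsAtRate_eq_riccatiRates hA hD hS hD_sym hS_sym]
  refine ⟨rfl, isGreatest_sSup_riccatiRates (hD_sym 0 self_mem_Ici) (hS_sym 0 self_mem_Ici),
    fun hpos => ?_⟩
  have hgreatest : IsGreatest (riccatiRates D S) _ :=
    riccatiRates_eq_Iic (fun t ht => (nonneg_iff_isPositive _).mpr (hpos t ht).1)
      (fun t ht => (nonneg_iff_isPositive _).mpr (hpos t ht).2) ▸ isGreatest_Iic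
  exact ⟨sSup_coe_image_of_isGreatest hgreatest, hgreatest⟩

theorem mainTheorem10 {𝕜 E : Type*} [RCLike 𝕜] [NormedAddCommGroup E] [InnerProductSpace 𝕜 E]
    [CompleteSpace E] [Nontrivial E] [NormedSpace ℝ E] [IsScalarTower ℝ 𝕜 E]
    (A D S : ℝ → E →L[𝕜] E)
    (hA : Continuous A) (hD : Continuous D) (hS : Continuous S)
    (hA_bdd : ∃ C : ℝ, ∀ t, ‖A t‖ ≤ C) (hD_bdd : ∃ C : ℝ, ∀ t, ‖D t‖ ≤ C)
    (hS_bdd : ∃ C : ℝ, ∀ t, ‖S t‖ ≤ C)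
    (hD_sym : ∀ t, D t ∈ Riccati.symOps 𝕜 E) (hS_sym : ∀ t, S t ∈ Riccati.symOps 𝕜 E) :
    -- the best contraction rate is the supremum, in `[-∞, +∞]`
    Riccati.bestContractionRate (Riccati.riccatiField A D S)
        (Riccati.symOps 𝕜 E) (Riccati.posInvOps 𝕜 E) =
      sSup ((fun β : ℝ => (β : EReal)) '' Riccati.riccatiRates D S) ∧
    -- when it is not `-∞`, it is finite and is itself an admissible rate
    ((Riccati.riccatiRates D S).Nonempty →
      IsGreatest {α : ℝ | Riccati.ContractsAtRate (Riccati.riccatiField A D S)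
        (Riccati.symOps 𝕜 E) (Riccati.posInvOps 𝕜 E) α} (sSup (Riccati.riccatiRates D S))) ∧
    -- positive semidefinite coefficients: the explicit formula
    ((∀ t, 0 ≤ t → (D t).IsPositive ∧ (S t).IsPositive) →
      Riccati.bestContractionRate (Riccati.riccatiField A D S)
          (Riccati.symOps 𝕜 E) (Riccati.posInvOps 𝕜 E) =
        ((2 * ⨅ t : Set.Ici (0 : ℝ), Real.sqrt (Riccati.lowerRatio
          (Riccati.opSqrt (S t) * D t * Riccati.opSqrt (S t)) (1 : E →L[𝕜] E)) : ℝ) : EReal) ∧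
      IsGreatest {α : ℝ | Riccati.ContractsAtRate (Riccati.riccatiField A D S)
          (Riccati.symOps 𝕜 E) (Riccati.posInvOps 𝕜 E) α}
        (2 * ⨅ t : Set.Ici (0 : ℝ), Real.sqrt (Riccati.lowerRatio
          (Riccati.opSqrt (S t) * D t * Riccati.opSqrt (S t)) (1 : E →L[𝕜] E)))) := by
  exact mainTheorem10_general A D S hA.continuousOn hD.continuousOn hS.continuousOn
    (fun t _ => hD_sym t) (fun t _ => hS_sym t)
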